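/- Let $X$ be a finite alphabet with at least two letters. A finite (invertible) automaton $\mathcal A$ over $X$ consists of a finite set of states, a transition function $(s,x)\mapsto s|_x$ and an output function $(s,x)\mapsto s(x)$ such that $x\mapsto s(x)$ is a permutation of $X$ for every state $s$. Each state acts on the space $X^\omega$ of right-infinite words by $s(xw)=s(x)\,s|_x(w)$, and this action is invertible; the automaton is assumed to be minimized, i.e. different states act differently on $X^\omega$. The Moore diagram of $\mathcal A$ has an arrow $s\to s|_x$ for each state $s$ and each letter $x$. A simple directed cycle in it is called trivial if it is a loop at a state acting trivially on $X^\omega$. The automaton $\mathcal A$ is called polynomial if different nontrivial simple directed cycles are disjoint (have no common state). Let $\mathcal A$ be a polynomial automaton, let $G$ be the group of transformations of $X^\omega$ generated by all states of $\mathcal A$, and let $T$ be any finite generating set of $G$. For $w\in X^\omega$, the orbital Schreier graph $\Gamma_w=\Gamma_w(G,T)$ has as vertex set the orbit $G(w)$, and two vertices $u,v$ are adjacent if there is $g\in T\cup T^{-1}$ with $g(u)=v$. Then for every $w\in X^\omega$ the graph $\Gamma_w$ is amenable: for every $\varepsilon>0$ there is a finite nonempty set $F$ of vertices of $\Gamma_w$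 such that the number of edges joining a vertex of $F$ to a vertex outside $F$ is at most $\varepsilon|F|$. -/

import Mathlib

/-- An invertible automaton with state set `S` over the alphabet `X`: a transition function and
an output function that is a permutation of the alphabet at every state. -/
structure InvAutomaton (S X : Type*) where
  /-- the transition function `(s, x) ↦ s|_x` -/
  next : S → X → S
  /-- the output function `(s, x) ↦ s(x)` -/
  out : S → Equiv.Perm X

namespace InvAutomaton

variable {S X : Type*} (A : InvAutomaton S X)

/-- The state reached from `s` after reading the first `n` letters of the infinite word `w`. -/
def stateAt (s : S) (w : ℕ → X) : ℕ → S
  | 0 => s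
  | n + 1 => A.next (stateAt s w n) (w n)

/-- The image of the infinite word `w` under the state `s`. -/
def act (s : S) (w : ℕ → X) : ℕ → X := fun n => A.out (A.stateAt s w n) (w n)

/-- The automaton with the same states that undoes the action of each state. -/
def inverse : InvAutomaton S X where
  next s y := A.next s ((A.out s).symm y)
  out s := (A.out s).symm

theorem inverse_stateAt_act (s : S) (w : ℕ → X) (n : ℕ) :
    A.inverse.stateAt s (A.act s w) n = A.stateAt s w n := by
  induction n with
  | zero => rfl
  | succ n ih =>
    rw [stateAt, ih]
    simp [stateAt, inverse, act]

theorem inverse_act_act (s : S) (w : ℕ → X) : A.inverse.act s (A.act s w) = w := by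
  funext n
  change A.inverse.out (A.inverse.stateAt s (A.act s w) n) (A.act s w n) = w n
  rw [inverse_stateAt_act]
  simp [inverse, act]

theorem inverse_inverse : A.inverse.inverse = A := by
  cases A
  simp [inverse]

theorem act_inverse_act (s : S) (w : ℕ → X) : A.act s (A.inverse.act s w) = w := by
  have h := A.inverse.inverse_act_act s w
  rwa [inverse_inverse] at h

/-- The transformation of the space of infinite words defined by the state `s`. -/
def perm (s : S) : Equiv.Perm (ℕ → X) where
  toFun := A.act s
  invFun := A.inverse.act s
  left_inv := A.inverse_act_act s
  right_inv := A.act_inverse_act s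

/-- The automaton is minimized: different states act differently on infinite words. -/
def IsMinimized : Prop := Function.Injective A.perm

/-- The automaton group: the group of transformations of the space of infinite words generated
by all states. -/
def group : Subgroup (Equiv.Perm (ℕ → X)) := Subgroup.closure (Set.range A.perm)

/-- The state `s|_v` reached from `s` after reading the finite word `v`. -/
def restrict (s : S) (v : List X) : S := v.foldl A.next s

/-- The arrows of the Moore diagram traversed from `s` along the finite word `v`; an arrow is
given by its source and its input letter, so that parallel arrows are distinct. -/
def arrows (s : S) : List X → List (S × X)
  | [] => []
  | x :: v => (s, x) :: arrows (A.next s x) v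

/-- The sources of the arrows traversed from `s` along `v`. -/
def visited (s : S) (v : List X) : List S := (A.arrows s v).map Prod.fst

/-- The path from `s` along `v` is a simple directed cycle of the Moore diagram. -/
def IsCycle (s : S) (v : List X) : Prop :=
  v ≠ [] ∧ A.restrict s v = s ∧ (A.visited s v).Nodup

/-- The path from `s` along `v` is a simple directed cycle that is not a loop at a state acting
trivially on infinite words. -/
def IsNontrivialCycle (s : S) (v : List X) : Prop :=
  A.IsCycle s v ∧ ¬ (v.length = 1 ∧ A.perm s = 1)

/-- Different nontrivial cycles of the Moore diagram are disjoint. Two cyclic paths represent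
the same cycle when their lists of arrows agree up to a rotation. -/
def IsPolynomial : Prop :=
  ∀ (s t : S) (u v : List X), A.IsNontrivialCycle s u → A.IsNontrivialCycle t v →
    ¬ (A.arrows s u).IsRotated (A.arrows t v) →
    (A.visited s u).Disjoint (A.visited t v)

end InvAutomaton

/-- The orbital Schreier graph at the point `w` of an action of a group `G` with respect to a
subset `T` of `G`: the vertices are the points of the orbit of `w`, and distinct vertices are
adjacent when an element of `T ∪ T⁻¹` takes one to the other. -/
def orbitalSchreierGraph {G α : Type*} [Group G] [MulAction G α] (T : Set G) (w : α) :
    SimpleGraph (MulAction.orbit G w) where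
  Adj u v := u ≠ v ∧ ∃ g : G, (g ∈ T ∨ g⁻¹ ∈ T) ∧ g • (u : α) = (v : α)
  symm := ⟨by
    rintro u v ⟨hne, g, hg, h⟩
    refine ⟨hne.symm, g⁻¹, ?_, ?_⟩
    · simpa [or_comm] using hg
    · rw [← h, inv_smul_smul]⟩
  loopless := ⟨fun _ h => h.1 rfl⟩

namespace SimpleGraph

/-- The edges joining a vertex of `F` to a vertex outside `F`, each one directed outwards. -/
def outwardBoundary {V : Type*} (Γ : SimpleGraph V) (F : Finset V) : Set (V × V) :=
  {e | e.1 ∈ F ∧ e.2 ∉ F ∧ Γ.Adj e.1 e.2}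

/-- Amenability of a graph: there are finite nonempty sets of vertices whose edge boundary is
finite and arbitrarily small in proportion to the set. -/
def IsAmenable {V : Type*} (Γ : SimpleGraph V) : Prop :=
  ∀ ε : ℝ, 0 < ε → ∃ F : Finset V, F.Nonempty ∧ (Γ.outwardBoundary F).Finite ∧
    ((Γ.outwardBoundary F).ncard : ℝ) ≤ ε * (F.card : ℝ)

end SimpleGraph

/-! The point is that balls in the orbits grow subexponentially, uniformly in the centre. Some ball
is then barely smaller than the next one, hence almost invariant under every state, and this passes
to any finite generating set.

Growth is treated by induction on the height of the states used (`height`). By polynomiality a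
nontrivial state keeps its height along at most one letter, so the words along which a state `s` of
height `H + 1` does not descend for a long time are close to one infinite word `c s`.

Read a word `g` of such states at a large depth `k`. A stretch of `g` whose letters have all
descended acts on the tail as a word of the same length in states of height at most `H`. The
remaining letters are grouped into runs, in which consecutive non-descending letters are separated
by fewer than `L` letters. If `k` is large in terms of `L`, short words taking `c s` close to `c t`
take it exactly to `c t`. A run starting at `s` therefore follows the orbit of `c s`, and the point
`v` it acts on can differ in behaviour from `c s` only beyond their first difference, where all
letters have descended (`IsRun.tail_mem_runEnds`). So a run has, up to a constant factor, no more
outcomes than a lower ball has points.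

Maximal runs are separated by at least `L` letters, so a word of length `n` splits into at most `2 *
(n / L) + 3` blocks (`tail_mem_chainEnds`). As `L` grows, the constants paid per block become
negligible on the exponential scale (`card_chainEnds_le`, `HasSubexpGrowth.succ`). -/

namespace InvAutomaton

/-! ### Tails of infinite words and the action of words of states. -/

section Words

variable {S X : Type*} (A : InvAutomaton S X)

/-- The infinite word obtained by deleting the first `k` letters. -/
def tail (k : ℕ) (w : ℕ → X) : ℕ → X := fun n => w (k + n)

/-- The infinite word whose first `k` letters are those of `a` and whose tail is `y`. -/
def join (k : ℕ) (a y : ℕ → X) : ℕ → X := fun i => if i < k then a i else y (i - k)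

theorem join_eq_of_eqOn {k : ℕ} {a w : ℕ → X} (h : Set.EqOn w a (Set.Iio k)) :
    join k a (tail k w) = w := by
  funext i
  by_cases hi : i < k
  · simp [join, hi, h hi]
  · simp only [join, hi, if_false, tail]
    congr 1
    omega

theorem stateAt_add (s : S) (w : ℕ → X) (k n : ℕ) :
    A.stateAt s w (k + n) = A.stateAt (A.stateAt s w k) (tail k w) n := by
  induction n with
  | zero => rfl
  | succ n ih =>
    rw [← add_assoc, stateAt, ih]
    rfl

theorem tail_act (s : S) (w : ℕ → X) (k : ℕ) :
    tail k (A.act s w) = A.act (A.stateAt s w k) (tail k w) := by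
  funext n
  simp only [tail, act, stateAt_add]

theorem stateAt_congr {s : S} {v w : ℕ → X} {n : ℕ} (h : Set.EqOn v w (Set.Iio n)) :
    A.stateAt s v n = A.stateAt s w n := by
  induction n with
  | zero => rfl
  | succ n ih =>
    rw [stateAt, stateAt, ih (h.mono (Set.Iio_subset_Iio n.le_succ)),
      h (Set.mem_Iio.2 n.lt_succ_self)]

theorem eqOn_act {s : S} {v w : ℕ → X} {n : ℕ} (h : Set.EqOn v w (Set.Iio n)) :
    Set.EqOn (A.act s v) (A.act s w) (Set.Iio n) := by
  intro i hi
  have hi' : i < n := hi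
  simp only [act]
  rw [h hi, A.stateAt_congr (h.mono (Set.Iio_subset_Iio hi'.le))]

theorem eqOn_act_iff {s : S} {v w : ℕ → X} {n : ℕ} :
    Set.EqOn (A.act s v) (A.act s w) (Set.Iio n) ↔ Set.EqOn v w (Set.Iio n) := by
  refine ⟨fun h => ?_, A.eqOn_act⟩
  have h' := A.inverse.eqOn_act (s := s) h
  rwa [inverse_act_act, inverse_act_act] at h'

/-- The action of a finite word of states, the first state of the list acting first. -/
def actWord (g : List S) (w : ℕ → X) : ℕ → X := g.foldl (fun v s => A.act s v) w

@[simp] theorem actWord_nil (w : ℕ → X) : A.actWord [] w = w := rfl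

@[simp] theorem actWord_cons (s : S) (g : List S) (w : ℕ → X) :
    A.actWord (s :: g) w = A.actWord g (A.act s w) := rfl

theorem actWord_append (g h : List S) (w : ℕ → X) :
    A.actWord (g ++ h) w = A.actWord h (A.actWord g w) := by
  simp [actWord]

theorem eqOn_actWord_iff {g : List S} {v w : ℕ → X} {n : ℕ} :
    Set.EqOn (A.actWord g v) (A.actWord g w) (Set.Iio n) ↔ Set.EqOn v w (Set.Iio n) := by
  induction g generalizing v w with
  | nil => rfl
  | cons s g ih => rw [actWord_cons, actWord_cons, ih, eqOn_act_iff]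

end Words

/-! ### Heights of states and their limit words. -/

section Heights

variable {S X : Type*} (A : InvAutomaton S X)

theorem restrict_cons (s : S) (x : X) (v : List X) :
    A.restrict s (x :: v) = A.restrict (A.next s x) v := rfl

theorem visited_cons (s : S) (x : X) (v : List X) :
    A.visited s (x :: v) = s :: A.visited (A.next s x) v := rfl

theorem exists_suffix_of_mem_visited {r s : S} {v : List X} (h : r ∈ A.visited s v) :
    ∃ u, A.restrict r u = A.restrict s v ∧ A.visited r u <:+ A.visited s v := by
  induction v generalizing s with
  | nil => simp [visited, arrows] at h
  | cons x v ih =>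
    rw [visited_cons, List.mem_cons] at h
    rcases h with rfl | h
    · exact ⟨x :: v, rfl, List.suffix_rfl⟩
    · obtain ⟨u, hu, hs⟩ := ih h
      exact ⟨u, hu, hs.trans (List.suffix_cons _ _)⟩

/-- Loop erasure: when the starting state reappears on the simple path already built, everything
before its reappearance is cut off. -/
theorem exists_simple_path (s : S) (v : List X) :
    ∃ u, A.restrict s u = A.restrict s v ∧ (A.visited s u).Nodup ∧
      A.restrict s v ∉ A.visited s u := by
  induction v generalizing s with
  | nil => exact ⟨[], rfl, by simp [visited, arrows], by simp [visited, arrows]⟩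
  | cons x v ih =>
    obtain ⟨u, hu, hn, hm⟩ := ih (A.next s x)
    rw [restrict_cons]
    by_cases hs : s = A.restrict (A.next s x) v
    · exact ⟨[], hs, by simp [visited, arrows], by simp [visited, arrows]⟩
    by_cases h : s ∈ A.visited (A.next s x) u
    · obtain ⟨u', hu', hs'⟩ := A.exists_suffix_of_mem_visited h
      exact ⟨u', hu'.trans hu, hn.sublist hs'.sublist, fun h' => hm (hs'.subset h')⟩
    · refine ⟨x :: u, hu, ?_, ?_⟩
      · rw [visited_cons]
        exact List.nodup_cons.2 ⟨h, hn⟩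
      · rw [visited_cons, List.mem_cons]
        rintro (h' | h')
        · exact hs h'.symm
        · exact hm h'

theorem eq_of_mem_arrows {s : S} {x y : X} {v : List X} (h : (A.visited s (x :: v)).Nodup)
    (hm : (s, y) ∈ A.arrows s (x :: v)) : y = x := by
  rw [visited_cons, List.nodup_cons] at h
  rw [arrows, List.mem_cons] at hm
  rcases hm with hm | hm
  · exact congrArg Prod.snd hm
  · exact absurd (List.mem_map_of_mem (f := Prod.fst) hm) h.1

/-- The states that can be reached from `s`. -/
def reachable (s : S) : Set S := Set.range (A.restrict s)

theorem reachable_next_subset (s : S) (x : X) : A.reachable (A.next s x) ⊆ A.reachable s := by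
  rintro _ ⟨v, rfl⟩
  exact ⟨x :: v, rfl⟩

theorem exists_cycle {s : S} {x : X} (h : s ∈ A.reachable (A.next s x)) :
    ∃ v, A.IsCycle s (x :: v) := by
  obtain ⟨v, hv⟩ := h
  obtain ⟨u, hu, hn, hm⟩ := A.exists_simple_path (A.next s x) v
  rw [hv] at hu hm
  refine ⟨u, by simp, hu, ?_⟩
  rw [visited_cons]
  exact List.nodup_cons.2 ⟨hm, hn⟩

variable {A} in
/-- A state acting nontrivially can be returned to after at most one letter. -/
theorem IsPolynomial.eq_of_mem_reachable (hA : A.IsPolynomial) {s : S} (hs : A.perm s ≠ 1)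
    {x y : X} (hx : s ∈ A.reachable (A.next s x)) (hy : s ∈ A.reachable (A.next s y)) :
    x = y := by
  obtain ⟨u, hu⟩ := A.exists_cycle hx
  obtain ⟨v, hv⟩ := A.exists_cycle hy
  by_contra hxy
  -- Both cycles pass through `s`, so they must coincide up to rotation; a simple cycle has only one
  -- arrow leaving `s`.
  refine hA s s _ _ ⟨hu, fun h => hs h.2⟩ ⟨hv, fun h => hs h.2⟩ (fun hrot => hxy ?_)
    (a := s) ?_ ?_
  · exact A.eq_of_mem_arrows hv.2.2 (hrot.mem_iff.1 (by simp [arrows]))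
  · simp [visited_cons]
  · simp [visited_cons]

theorem perm_next_eq_one {s : S} (h : A.perm s = 1) (x : X) : A.perm (A.next s x) = 1 := by
  ext1 w
  have h1 : ∀ v, A.act s v = v := fun v => congrArg (fun f : Equiv.Perm (ℕ → X) => f v) h
  have h2 := A.tail_act s (fun n => Nat.casesOn n x w) 1
  rw [h1] at h2
  have h3 : tail 1 (fun n => Nat.casesOn n x w : ℕ → X) = w := by
    funext n
    simp [tail, add_comm 1 n]
  rw [h3] at h2
  exact h2.symm

open Classical in
/-- The height of a state: zero for a state acting trivially, and the number of states reachable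
from it otherwise. -/
noncomputable def height (s : S) : ℕ := if A.perm s = 1 then 0 else (A.reachable s).ncard

variable [Finite S]

theorem height_next_le (s : S) (x : X) : A.height (A.next s x) ≤ A.height s := by
  by_cases h : A.perm s = 1
  · simp [height, A.perm_next_eq_one h x]
  · by_cases h' : A.perm (A.next s x) = 1
    · simp [height, h']
    · simp only [height, h, h', if_false]
      exact Set.ncard_le_ncard (A.reachable_next_subset s x) (Set.toFinite _)

theorem height_stateAt_antitone (s : S) (w : ℕ → X) :
    Antitone fun n => A.height (A.stateAt s w n) :=
  antitone_nat_of_succ_le fun _ => A.height_next_le _ _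

-- Since the reachable sets are nested and finite, equal nonzero heights make them equal, so `s` can
-- be reached again from its successor.
variable {A} in
theorem IsPolynomial.eq_of_height_next_eq (hA : A.IsPolynomial) {s : S} (hs : A.height s ≠ 0)
    {x y : X} (hx : A.height (A.next s x) = A.height s)
    (hy : A.height (A.next s y) = A.height s) : x = y := by
  have h1 : A.perm s ≠ 1 := fun h => hs (by simp [height, h])
  have key : ∀ z, A.height (A.next s z) = A.height s → s ∈ A.reachable (A.next s z) := by
    intro z hz
    have h2 : A.perm (A.next s z) ≠ 1 := fun h => hs (by rw [← hz]; simp [height, h])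
    simp only [height, h1, h2, if_false] at hz
    rw [Set.eq_of_subset_of_ncard_le (A.reachable_next_subset s z) hz.ge (Set.toFinite _)]
    exact ⟨[], rfl⟩
  exact hA.eq_of_mem_reachable h1 (key x hx) (key y hy)

variable {A} in
/-- Two words along which a state keeps its height for `n` steps share their first `n` letters. -/
theorem IsPolynomial.eqOn_of_lt_height_stateAt (hA : A.IsPolynomial) {s : S} {H : ℕ}
    (hs : A.height s ≤ H + 1) {v w : ℕ → X} {n : ℕ} (hv : H < A.height (A.stateAt s v n))
    (hw : H < A.height (A.stateAt s w n)) : Set.EqOn v w (Set.Iio n) := by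
  induction n with
  | zero => intro i hi; exact absurd hi (Nat.not_lt_zero i)
  | succ n ih =>
    have hv' := hv.trans_le (A.height_next_le _ _)
    have hw' := hw.trans_le (A.height_next_le _ _)
    have h := ih hv' hw'
    have hle : A.height (A.stateAt s v n) ≤ H + 1 :=
      (A.height_stateAt_antitone s v (Nat.zero_le n)).trans hs
    rw [stateAt] at hv hw
    rw [← A.stateAt_congr h] at hw
    intro i hi
    rcases Nat.lt_succ_iff_lt_or_eq.1 hi with hi | rfl
    · exact h hi
    · exact hA.eq_of_height_next_eq (s := A.stateAt s v i) (by omega)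
        (le_antisymm (A.height_next_le _ _) (by omega))
        (le_antisymm (A.height_next_le _ _) (by omega))

variable {A} in
/-- All words along which the state `s` keeps its height for a long time are close to a single
infinite word. -/
theorem IsPolynomial.exists_limit_word [Nonempty X] (hA : A.IsPolynomial) {s : S} {H : ℕ}
    (hs : A.height s ≤ H + 1) :
    ∃ c : ℕ → X, ∀ᶠ k in Filter.atTop, ∀ n, k ≤ n → ∀ v,
      H < A.height (A.stateAt s v n) → Set.EqOn v c (Set.Iio n) := by
  -- If all words descend within a uniform depth `m`, the claim is vacuous beyond `m` and any word
  -- serves. Otherwise every depth has a surviving word; these agree on common prefixes, and their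
  -- diagonal is the limit.
  by_cases h : ∃ m, ∀ v, A.height (A.stateAt s v m) ≤ H
  · obtain ⟨m, hm⟩ := h
    refine ⟨fun _ => Classical.arbitrary X, Filter.eventually_atTop.2 ⟨m, fun k hk n hn v hv => ?_⟩⟩
    exact absurd hv (not_lt.2 ((A.height_stateAt_antitone s v (hk.trans hn)).trans (hm v)))
  · push Not at h
    choose u hu using h
    refine ⟨fun i => u (i + 1) i, Filter.Eventually.of_forall fun _ n _ v hv i hi => ?_⟩
    exact hA.eqOn_of_lt_height_stateAt hs
      (hv.trans_le (A.height_stateAt_antitone s v (Nat.succ_le_of_lt hi))) (hu (i + 1))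
      (Set.mem_Iio.2 i.lt_succ_self)

end Heights

end InvAutomaton

/-! ### Counting the endpoints of chains of steps. -/

open Classical in
/-- The endpoints of chains of `q` consecutive steps of total size at most `n`, where `step m y`
is the set of results of a step of size `m` from `y`. -/
noncomputable def chainEnds {Y : Type*} (step : ℕ → Y → Finset Y) : ℕ → ℕ → Y → Finset Y
  | 0, _, y => {y}
  | q + 1, n, y => (Finset.range (n + 1)).biUnion fun m =>
      (step m y).biUnion fun z => chainEnds step q (n - m) z

section Chains

variable {Y : Type*} {step : ℕ → Y → Finset Y}

theorem mem_chainEnds_succ {q n m : ℕ} {x y z : Y} (hm : m ≤ n) (hy : y ∈ step m x)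
    (hz : z ∈ chainEnds step q (n - m) y) : z ∈ chainEnds step (q + 1) n x := by
  simp only [chainEnds, Finset.mem_biUnion, Finset.mem_range]
  exact ⟨m, by omega, y, hy, hz⟩

/-- A chain can be padded with steps of size zero that stay put. -/
theorem chainEnds_mono (h0 : ∀ y, y ∈ step 0 y) {p q : ℕ} (hpq : p ≤ q) (n : ℕ) (y : Y) :
    chainEnds step p n y ⊆ chainEnds step q n y := by
  induction q, hpq using Nat.le_induction with
  | base => exact subset_rfl
  | succ q _ ih => exact fun z hz => mem_chainEnds_succ (Nat.zero_le n) (h0 y) (ih hz)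

-- Summing over the size of the first step gives a geometric series of ratio `a / b`. Raising the
-- rate from `a` to `b` thus absorbs the choice of sizes, at a constant cost per step.
open Classical in
theorem card_chainEnds_le {C a b : ℝ} (hC : 0 ≤ C) (ha : 0 < a) (hab : a < b)
    (h : ∀ m y, ((step m y).card : ℝ) ≤ C * a ^ m) (q n : ℕ) (hn : 1 ≤ b) (y : Y) :
    ((chainEnds step q n y).card : ℝ) ≤ (C * (1 - a / b)⁻¹) ^ q * b ^ n := by
  have hb : 0 < b := ha.trans hab
  have hr : a / b < 1 := (div_lt_one hb).2 hab
  have hr0 : 0 < a / b := div_pos ha hb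
  induction q generalizing n y with
  | zero => simpa [chainEnds] using one_le_pow₀ hn
  | succ q ih =>
    set E := C * (1 - a / b)⁻¹ with hE
    have hE0 : 0 ≤ E := mul_nonneg hC (inv_nonneg.2 (by linarith))
    have hstep : ∀ m ∈ Finset.range (n + 1),
        (((step m y).biUnion fun z => chainEnds step q (n - m) z).card : ℝ) ≤
          C * E ^ q * b ^ n * (a / b) ^ m := by
      intro m hm
      have hmn : m ≤ n := by simpa [Nat.lt_succ_iff] using hm
      calc (((step m y).biUnion fun z => chainEnds step q (n - m) z).card : ℝ)
          ≤ ∑ z ∈ step m y, ((chainEnds step q (n - m) z).card : ℝ) := by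
            exact_mod_cast Finset.card_biUnion_le
        _ ≤ ∑ z ∈ step m y, E ^ q * b ^ (n - m) := Finset.sum_le_sum fun z _ => ih _ _
        _ = (step m y).card * (E ^ q * b ^ (n - m)) := by simp
        _ ≤ C * a ^ m * (E ^ q * b ^ (n - m)) := by
            gcongr
            exact h m y
        _ = C * E ^ q * b ^ n * (a / b) ^ m := by
            rw [div_pow, pow_sub₀ b hb.ne' hmn]
            field_simp
    calc ((chainEnds step (q + 1) n y).card : ℝ)
        ≤ ∑ m ∈ Finset.range (n + 1),
            (((step m y).biUnion fun z => chainEnds step q (n - m) z).card : ℝ) := by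
          rw [chainEnds]
          exact_mod_cast Finset.card_biUnion_le
      _ ≤ ∑ m ∈ Finset.range (n + 1), C * E ^ q * b ^ n * (a / b) ^ m :=
          Finset.sum_le_sum hstep
      _ = C * E ^ q * b ^ n * ∑ m ∈ Finset.range (n + 1), (a / b) ^ m := by
          rw [Finset.mul_sum]
      _ ≤ C * E ^ q * b ^ n * (1 - a / b)⁻¹ := by
          gcongr
          rw [← tsum_geometric_of_lt_one hr0.le hr]
          exact (summable_geometric_of_lt_one hr0.le hr).sum_le_tsum _
            (fun _ _ => pow_nonneg hr0.le _)
      _ = E ^ (q + 1) * b ^ n := by rw [hE]; ring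

end Chains

/-! ### Balls, descending words and runs. -/

namespace InvAutomaton

variable {S X : Type*} (A : InvAutomaton S X)

/-- The points reached from `w` by words of length at most `n` in the states of height at
most `H`. -/
def ball (H n : ℕ) (w : ℕ → X) : Set (ℕ → X) :=
  {y | ∃ g : List S, g.length ≤ n ∧ (∀ s ∈ g, A.height s ≤ H) ∧ A.actWord g w = y}

theorem self_mem_ball (H n : ℕ) (w : ℕ → X) : w ∈ A.ball H n w :=
  ⟨[], by simp, by simp, rfl⟩

theorem finite_ball [Finite S] (H n : ℕ) (w : ℕ → X) : (A.ball H n w).Finite := by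
  refine ((List.finite_length_le S n).image fun g => A.actWord g w).subset ?_
  rintro _ ⟨g, hg, -, rfl⟩
  exact ⟨g, hg, rfl⟩

/-- The letters of the word `g` act along the orbit of `v` so that after reading `k` letters of
the point each of them has turned into a state of height at most `H`. -/
def Descends (H k : ℕ) : List S → (ℕ → X) → Prop
  | [], _ => True
  | s :: g, v => A.height (A.stateAt s v k) ≤ H ∧ Descends H k g (A.act s v)

variable {A}

theorem descends_append {H k : ℕ} {g h : List S} {v : ℕ → X} :
    A.Descends H k (g ++ h) v ↔ A.Descends H k g v ∧ A.Descends H k h (A.actWord g v) := by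
  induction g generalizing v with
  | nil => simp [Descends]
  | cons s g ih => simp [Descends, ih, and_assoc]

theorem Descends.mono [Finite S] {H k m : ℕ} (hkm : k ≤ m) {g : List S} {v : ℕ → X}
    (h : A.Descends H k g v) : A.Descends H m g v := by
  induction g generalizing v with
  | nil => trivial
  | cons s g ih => exact ⟨(A.height_stateAt_antitone s v hkm).trans h.1, ih h.2⟩

theorem exists_split_of_not_descends {H k : ℕ} {g : List S} {v : ℕ → X}
    (h : ¬ A.Descends H k g v) : ∃ l t r, g = l ++ t :: r ∧ A.Descends H k l v ∧
      H < A.height (A.stateAt t (A.actWord l v) k) := by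
  induction g generalizing v with
  | nil => exact absurd trivial h
  | cons s g ih =>
    by_cases hs : A.height (A.stateAt s v k) ≤ H
    · obtain ⟨l, t, r, rfl, hl, ht⟩ := ih fun h' => h ⟨hs, h'⟩
      exact ⟨s :: l, t, r, rfl, ⟨hs, hl⟩, ht⟩
    · exact ⟨[], s, g, rfl, trivial, not_le.1 hs⟩

/-- Each letter acts on the tail through the state it has turned into after `k` letters, and these
states form a word of the same length. -/
theorem Descends.tail_mem_ball {H k : ℕ} {g : List S} {v : ℕ → X} (h : A.Descends H k g v)
    {n : ℕ} (hn : g.length ≤ n) : tail k (A.actWord g v) ∈ A.ball H n (tail k v) := by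
  suffices ∃ g' : List S, g'.length = g.length ∧ (∀ s ∈ g', A.height s ≤ H) ∧
      A.actWord g' (tail k v) = tail k (A.actWord g v) by
    obtain ⟨g', hl, hs, he⟩ := this
    exact ⟨g', hl.trans_le hn, hs, he⟩
  clear hn
  induction g generalizing v with
  | nil => exact ⟨[], rfl, by simp, rfl⟩
  | cons s g ih =>
    obtain ⟨g', hl, hs, he⟩ := ih h.2
    refine ⟨A.stateAt s v k :: g', by simp [hl], ?_, ?_⟩
    · simpa using ⟨h.1, hs⟩
    · rw [actWord_cons, ← tail_act, he, actWord_cons]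

/-- A word acting at the point `v` that begins and ends with letters keeping their height for `k`
steps, and which takes the limit word of the first to the limit word of the last one. -/
def IsRun (A : InvAutomaton S X) (c : S → ℕ → X) (H k : ℕ) (u : List S) (v : ℕ → X) : Prop :=
  ∃ s g t, u = g ++ [t] ∧ Set.EqOn v (c s) (Set.Iio k) ∧ A.actWord g (c s) = c t ∧
    ∀ n, k ≤ n → ¬ Set.EqOn v (c s) (Set.Iio n) → A.Descends H n u v

/-- A bound for the tails of the results of runs of length `m` at points with tail `y`. -/
noncomputable def runEnds (A : InvAutomaton S X) (c : S → ℕ → X) (H k m : ℕ) (y : ℕ → X) :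
    Set (ℕ → X) :=
  ⋃ s, ⋃ t, insert (tail k (A.act t (c t))) (⋃ x : X,
    (fun z => tail k (join (PiNat.firstDiff (join k (c s) y) (c s) + 1)
      (Function.update (A.act t (c t)) (PiNat.firstDiff (join k (c s) y) (c s)) x) z)) ''
    A.ball H m (tail (PiNat.firstDiff (join k (c s) y) (c s) + 1) (join k (c s) y)))

/-- The run sends `c s` to the known word `A.act t (c t)`. Up to the first difference `N` of `v` and
`c s` the result copies that word, at `N` it has some letter, and beyond `N` the run acts as a word
of states of height at most `H`. -/
theorem IsRun.tail_mem_runEnds {c : S → ℕ → X} {H k m : ℕ} {u : List S} {v : ℕ → X}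
    (h : A.IsRun c H k u v) (hm : u.length ≤ m) :
    tail k (A.actWord u v) ∈ A.runEnds c H k m (tail k v) := by
  obtain ⟨s, g, t, rfl, hv, hg, hd⟩ := h
  simp only [runEnds, Set.mem_iUnion]
  refine ⟨s, t, ?_⟩
  -- The first `k` letters of `v` are those of `c s`, so the tail and `s` determine `v`, hence also
  -- `N`.
  rw [join_eq_of_eqOn hv]
  have hact : A.actWord (g ++ [t]) (c s) = A.act t (c t) := by
    rw [actWord_append, hg]
    rfl
  by_cases hvs : v = c s
  · left
    rw [hvs, hact]
  right
  set N := PiNat.firstDiff v (c s) with hN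
  have hne : v N ≠ c s N := PiNat.apply_firstDiff_ne hvs
  have hlt : ∀ i < N, v i = c s i := fun i hi => PiNat.apply_eq_of_lt_firstDiff hi
  have hkN : k ≤ N := by
    by_contra hlt'
    exact hne (hv (not_le.1 hlt'))
  have hdes : A.Descends H (N + 1) (g ++ [t]) v :=
    hd _ (by omega) fun he => hne (he (Set.mem_Iio.2 N.lt_succ_self))
  refine Set.mem_iUnion.2 ⟨A.actWord (g ++ [t]) v N, _, hdes.tail_mem_ball hm, ?_⟩
  dsimp only
  rw [join_eq_of_eqOn]
  intro i hi
  rcases Nat.lt_succ_iff_lt_or_eq.1 hi with hi | rfl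
  · rw [Function.update_of_ne hi.ne, ← hact]
    exact A.eqOn_actWord_iff.2 (fun j hj => hlt j hj) hi
  · simp

theorem finite_runEnds [Finite S] [Finite X] (c : S → ℕ → X) (H k m : ℕ) (y : ℕ → X) :
    (A.runEnds c H k m y).Finite :=
  Set.finite_iUnion fun _ => Set.finite_iUnion fun _ => (Set.finite_iUnion fun _ =>
    (A.finite_ball H m _).image _).insert _

theorem _root_.Set.ncard_iUnion_le_mul {ι α : Type*} [Finite ι] {f : ι → Set α} (hf : ∀ i, (f i).Finite)
    {B : ℝ} (h : ∀ i, ((f i).ncard : ℝ) ≤ B) :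
    ((⋃ i, f i).ncard : ℝ) ≤ Nat.card ι * B := by
  classical
  have := Fintype.ofFinite ι
  have h1 : (⋃ i, f i) = ((Finset.univ.biUnion fun i => (hf i).toFinset : Finset α) : Set α) := by
    ext
    simp
  rw [h1, Set.ncard_coe_finset]
  calc ((Finset.univ.biUnion fun i => (hf i).toFinset).card : ℝ)
      ≤ ∑ i, ((hf i).toFinset.card : ℝ) := by exact_mod_cast Finset.card_biUnion_le
    _ ≤ ∑ _i : ι, B := Finset.sum_le_sum fun i _ => by
        rw [← Set.ncard_eq_toFinset_card _ (hf i)]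
        exact h i
    _ = Nat.card ι * B := by simp

theorem ncard_runEnds_le [Finite S] [Finite X] (c : S → ℕ → X) {H m : ℕ} {B : ℝ}
    (hB : ∀ w, ((A.ball H m w).ncard : ℝ) ≤ B) (k : ℕ) (y : ℕ → X) :
    ((A.runEnds c H k m y).ncard : ℝ) ≤ Nat.card S * (Nat.card S * (Nat.card X * B + 1)) := by
  refine Set.ncard_iUnion_le_mul (fun s => ?_) fun s => Set.ncard_iUnion_le_mul (fun t => ?_) fun t => ?_
  · exact Set.finite_iUnion fun _ => (Set.finite_iUnion fun _ =>
      (A.finite_ball H m _).image _).insert _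
  · exact (Set.finite_iUnion fun _ => (A.finite_ball H m _).image _).insert _
  · refine (Nat.cast_le.2 (Set.ncard_insert_le _ _)).trans ?_
    push_cast
    gcongr
    refine Set.ncard_iUnion_le_mul (fun x => (A.finite_ball H m _).image _) fun x => ?_
    exact (Nat.cast_le.2 (Set.ncard_image_le (A.finite_ball H m _))).trans (hB _)

/-- The possible effects of a run, or of a word all of whose letters descend, on the tail of a
point. -/
noncomputable def blockEnds [Finite S] [Finite X] (A : InvAutomaton S X) (c : S → ℕ → X)
    (H k m : ℕ) (y : ℕ → X) : Finset (ℕ → X) :=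
  ((A.finite_ball H m y).union (A.finite_runEnds c H k m y)).toFinset

/-! ### Splitting a word into descending blocks and maximal runs. -/

section Decomposition

variable [Finite S] {c : S → ℕ → X} {H k L : ℕ}

/-- As long as a non-descending letter occurs among the next `L` letters, the run is extended to
include the first such letter; the remainder gets shorter each time. -/
theorem IsRun.exists_maximal (hc : ∀ s, A.height s ≤ H + 1 → ∀ n, k ≤ n → ∀ v,
      H < A.height (A.stateAt s v n) → Set.EqOn v (c s) (Set.Iio n))
    (hL : ∀ g : List S, g.length ≤ L → ∀ s t,
      Set.EqOn (A.actWord g (c s)) (c t) (Set.Iio k) → A.actWord g (c s) = c t)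
    {u r : List S} {v : ℕ → X} (hr : ∀ s ∈ r, A.height s ≤ H + 1) (hu : A.IsRun c H k u v) :
    ∃ u' r', u ++ r = u' ++ r' ∧ A.IsRun c H k u' v ∧
      A.Descends H k (r'.take L) (A.actWord u' v) := by
  induction hn : r.length using Nat.strong_induction_on generalizing u r with
  | _ n ih =>
    by_cases hd : A.Descends H k (r.take L) (A.actWord u v)
    · exact ⟨u, r, rfl, hu, hd⟩
    obtain ⟨l, t', r0, hl, hdl, ht'⟩ := exists_split_of_not_descends hd
    have hr' : r = l ++ t' :: (r0 ++ r.drop L) := by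
      conv_lhs => rw [← List.take_append_drop L r, hl]
      simp
    have hlen : l.length + 1 ≤ L := by
      have := congrArg List.length hl
      simp only [List.length_take, List.length_append, List.length_cons] at this
      omega
    obtain ⟨s, g, t, rfl, hv, hg, hdes⟩ := hu
    generalize r0 ++ r.drop L = r1 at hr'
    subst hr'
    have ht'H : A.height t' ≤ H + 1 := hr t' (by simp)
    have hgl : A.actWord (g ++ [t] ++ l) (c s) = c t' := by
      rw [List.append_assoc, actWord_append, hg]
      -- The connecting word `t :: l` has length at most `L`. The current point shadows the orbit of
      -- `c s` to depth `k` and is close to `c t'`, so `hL` turns closeness of the orbit to `c t'`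
      -- into equality.
      refine hL _ (by simpa [add_comm] using hlen) _ _ ?_
      rw [← hg, ← actWord_append, ← List.append_assoc]
      refine ((A.eqOn_actWord_iff.2 hv).symm).trans ?_
      rw [actWord_append]
      exact hc t' ht'H k le_rfl _ ht'
    obtain ⟨u', r', he, hrun, hdr⟩ := ih r1.length (by simp at hn; omega) (r := r1)
      (u := g ++ [t] ++ l ++ [t']) (fun s hs => hr s (by simp [hs]))
      ⟨s, g ++ [t] ++ l, t', rfl, hv, hgl, fun n hn hne => by
        refine descends_append.2 ⟨descends_append.2 ⟨hdes n hn hne, hdl.mono hn⟩, ?_, trivial⟩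
        -- If `t'` kept its height to depth `n`, the current point would agree with `c t'` that far;
        -- undoing the word, `v` would agree with `c s`.
        by_contra hlt
        refine hne (A.eqOn_actWord_iff (g := g ++ [t] ++ l).1 ?_)
        rw [hgl]
        exact hc t' ht'H n hn _ (not_le.1 hlt)⟩ rfl
    exact ⟨u', r', by rw [← he]; simp, hrun, hdr⟩

theorem exists_run (hc : ∀ s, A.height s ≤ H + 1 → ∀ n, k ≤ n → ∀ v,
      H < A.height (A.stateAt s v n) → Set.EqOn v (c s) (Set.Iio n))
    (hL : ∀ g : List S, g.length ≤ L → ∀ s t,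
      Set.EqOn (A.actWord g (c s)) (c t) (Set.Iio k) → A.actWord g (c s) = c t)
    {s : S} {r : List S} {v : ℕ → X} (hr : ∀ t ∈ s :: r, A.height t ≤ H + 1)
    (hs : H < A.height (A.stateAt s v k)) :
    ∃ u r', s :: r = u ++ r' ∧ A.IsRun c H k u v ∧
      A.Descends H k (r'.take L) (A.actWord u v) := by
  have hsH : A.height s ≤ H + 1 := hr s (by simp)
  refine IsRun.exists_maximal (u := [s]) hc hL (fun t ht => hr t (by simp [ht]))
    ⟨s, [], s, rfl, hc s hsH k le_rfl v hs, rfl, fun n hn hne => ⟨?_, trivial⟩⟩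
  by_contra hlt
  exact hne (hc s hsH n hn v (not_le.1 hlt))

variable [Finite X]

theorem self_mem_blockEnds (m : ℕ) (y : ℕ → X) : y ∈ A.blockEnds c H k m y := by
  simp [blockEnds, self_mem_ball]

theorem tail_mem_chainEnds_of_descends {g : List S} {v : ℕ → X} {n q : ℕ} (hq : 1 ≤ q)
    (hn : g.length ≤ n) (h : A.Descends H k g v) :
    tail k (A.actWord g v) ∈ chainEnds (A.blockEnds c H k) q n (tail k v) := by
  refine chainEnds_mono (self_mem_blockEnds 0) hq _ _ (mem_chainEnds_succ (m := n) le_rfl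
    (y := tail k (A.actWord g v)) ?_ (by simp [chainEnds]))
  simp [blockEnds, h.tail_mem_ball hn]

/-- Each descending block followed by a maximal run uses up at least `L` letters and again leaves a
remainder whose first `L` letters descend: two blocks per `L` letters, plus a final one. -/
theorem tail_mem_chainEnds_of_take_descends (hL0 : 0 < L)
    (hc : ∀ s, A.height s ≤ H + 1 → ∀ n, k ≤ n → ∀ v,
      H < A.height (A.stateAt s v n) → Set.EqOn v (c s) (Set.Iio n))
    (hL : ∀ g : List S, g.length ≤ L → ∀ s t,
      Set.EqOn (A.actWord g (c s)) (c t) (Set.Iio k) → A.actWord g (c s) = c t)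
    (n : ℕ) {g : List S} {v : ℕ → X} (hg : ∀ s ∈ g, A.height s ≤ H + 1) (hn : g.length ≤ n)
    (hd : A.Descends H k (g.take L) v) :
    tail k (A.actWord g v) ∈ chainEnds (A.blockEnds c H k) (2 * (n / L) + 1) n (tail k v) := by
  induction n using Nat.strong_induction_on generalizing g v with
  | _ n ih =>
    by_cases hdg : A.Descends H k g v
    · exact tail_mem_chainEnds_of_descends (by omega) hn hdg
    obtain ⟨l, s, r, rfl, hl, hs⟩ := exists_split_of_not_descends hdg
    have hlL : L ≤ l.length := by
      by_contra hlt
      obtain ⟨j, hj⟩ : ∃ j, L - l.length = j + 1 := ⟨L - l.length - 1, by omega⟩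
      rw [List.take_append, List.take_of_length_le (by omega), hj, List.take_succ_cons] at hd
      exact absurd (descends_append.1 hd).2.1 (not_le.2 hs)
    obtain ⟨u, r', he, hu, hr'⟩ := exists_run (r := r) hc hL
      (fun t ht => hg t (List.mem_append_right l ht)) hs
    rw [he] at hg hn ⊢
    simp only [List.length_append] at hn
    have hle : (n - l.length - u.length) / L + 1 ≤ n / L := by
      rw [← Nat.add_div_right _ hL0]
      exact Nat.div_le_div_right (by omega)
    refine chainEnds_mono (self_mem_blockEnds 0)
      (show 2 * ((n - l.length - u.length) / L) + 1 + 1 + 1 ≤ _ by omega) _ _ ?_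
    refine mem_chainEnds_succ (m := l.length) (y := tail k (A.actWord l v)) (by omega) ?_
      (mem_chainEnds_succ (m := u.length) (y := tail k (A.actWord u (A.actWord l v)))
        (by omega) ?_ ?_)
    · simp [blockEnds, hl.tail_mem_ball le_rfl]
    · simp [blockEnds, hu.tail_mem_runEnds le_rfl]
    · rw [actWord_append, actWord_append]
      exact ih _ (by omega) (fun t ht => hg t (by simp [ht])) (by omega) hr'

/-- Only the initial descending block may be shorter than `L`; it and the first run account for the
two additional blocks. -/
theorem tail_mem_chainEnds (hL0 : 0 < L)
    (hc : ∀ s, A.height s ≤ H + 1 → ∀ n, k ≤ n → ∀ v,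
      H < A.height (A.stateAt s v n) → Set.EqOn v (c s) (Set.Iio n))
    (hL : ∀ g : List S, g.length ≤ L → ∀ s t,
      Set.EqOn (A.actWord g (c s)) (c t) (Set.Iio k) → A.actWord g (c s) = c t)
    (n : ℕ) {g : List S} {v : ℕ → X} (hg : ∀ s ∈ g, A.height s ≤ H + 1) (hn : g.length ≤ n) :
    tail k (A.actWord g v) ∈ chainEnds (A.blockEnds c H k) (2 * (n / L) + 3) n (tail k v) := by
  by_cases hdg : A.Descends H k g v
  · exact tail_mem_chainEnds_of_descends (by omega) hn hdg
  obtain ⟨l, s, r, rfl, hl, hs⟩ := exists_split_of_not_descends hdg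
  obtain ⟨u, r', he, hu, hr'⟩ := exists_run (r := r) hc hL
      (fun t ht => hg t (List.mem_append_right l ht)) hs
  rw [he] at hg hn ⊢
  simp only [List.length_append] at hn
  have hle : (n - l.length - u.length) / L ≤ n / L := Nat.div_le_div_right (by omega)
  refine chainEnds_mono (self_mem_blockEnds 0)
    (show 2 * ((n - l.length - u.length) / L) + 1 + 1 + 1 ≤ _ by omega) _ _ ?_
  refine mem_chainEnds_succ (m := l.length) (y := tail k (A.actWord l v)) (by omega) ?_
    (mem_chainEnds_succ (m := u.length) (y := tail k (A.actWord u (A.actWord l v)))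
      (by omega) ?_ ?_)
  · simp [blockEnds, hl.tail_mem_ball le_rfl]
  · simp [blockEnds, hu.tail_mem_runEnds le_rfl]
  · rw [actWord_append, actWord_append]
    exact tail_mem_chainEnds_of_take_descends hL0 hc hL _ (fun t ht => hg t (by simp [ht]))
      (by omega) hr'

end Decomposition

/-! ### Subexponential growth by induction on the height. -/

/-- The orbits of the words in the states of height at most `H` have subexponential growth. -/
def HasSubexpGrowth (A : InvAutomaton S X) (H : ℕ) : Prop :=
  ∀ a : ℝ, 1 < a → ∃ K : ℝ, ∀ n w, ((A.ball H n w).ncard : ℝ) ≤ K * a ^ n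

theorem hasSubexpGrowth_zero [Finite S] : A.HasSubexpGrowth 0 := by
  intro a ha
  refine ⟨1, fun n w => ?_⟩
  have h : A.ball 0 n w ⊆ {w} := by
    rintro _ ⟨g, -, hg, rfl⟩
    induction g with
    | nil => rfl
    | cons s g ih =>
      have h1 : A.act s w = w := by
        have h0 : A.height s ≤ 0 := hg s (by simp)
        by_cases hs : A.perm s = 1
        · exact congrArg (fun f : Equiv.Perm (ℕ → X) => f w) hs
        · have : (A.reachable s).ncard ≠ 0 :=
            Set.ncard_ne_zero_of_mem (a := s) ⟨[], rfl⟩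
          simp only [height, hs, if_false] at h0
          omega
      rw [actWord_cons, h1]
      exact ih fun t ht => hg t (by simp [ht])
  have h2 := Set.ncard_le_ncard h
  rw [Set.ncard_singleton] at h2
  calc ((A.ball 0 n w).ncard : ℝ) ≤ 1 := by exact_mod_cast h2
    _ ≤ 1 * a ^ n := by simpa using one_le_pow₀ ha.le

/-- Only finitely many triples `g`, `s`, `t` occur, and each unequal pair of words differs at some
finite position. -/
theorem exists_uniform_depth [Finite S] (c : S → ℕ → X) (L : ℕ) :
    ∀ᶠ k in Filter.atTop, ∀ g : List S, g.length ≤ L → ∀ s t,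
      Set.EqOn (A.actWord g (c s)) (c t) (Set.Iio k) → A.actWord g (c s) = c t := by
  refine (Filter.eventually_all_finite (List.finite_length_le S L)).2 fun g _ => ?_
  refine Filter.eventually_all.2 fun s => Filter.eventually_all.2 fun t => ?_
  by_cases h : A.actWord g (c s) = c t
  · exact Filter.Eventually.of_forall fun _ _ => h
  · obtain ⟨i, hi⟩ := Function.ne_iff.1 h
    filter_upwards [Filter.eventually_gt_atTop i] with k hk he
    exact absurd (he hk) hi

/-- A point is determined by its first `k` letters and its tail, and the tail is the end of a chain
of blocks. -/
theorem ncard_ball_succ_le [Finite S] [Finite X] {c : S → ℕ → X} {H k L : ℕ} (hL0 : 0 < L)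
    (hc : ∀ s, A.height s ≤ H + 1 → ∀ n, k ≤ n → ∀ v,
      H < A.height (A.stateAt s v n) → Set.EqOn v (c s) (Set.Iio n))
    (hL : ∀ g : List S, g.length ≤ L → ∀ s t,
      Set.EqOn (A.actWord g (c s)) (c t) (Set.Iio k) → A.actWord g (c s) = c t)
    (n : ℕ) (w : ℕ → X) : (A.ball (H + 1) n w).ncard ≤
      Nat.card X ^ k * (chainEnds (A.blockEnds c H k) (2 * (n / L) + 3) n (tail k w)).card := by
  set Q := chainEnds (A.blockEnds c H k) (2 * (n / L) + 3) n (tail k w)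
  let f : (Fin k → X) × Q → (ℕ → X) := fun p i =>
    if h : i < k then p.1 ⟨i, h⟩ else p.2.1 (i - k)
  have hsub : A.ball (H + 1) n w ⊆ Set.range f := by
    rintro _ ⟨g, hn, hg, rfl⟩
    refine ⟨(fun i => A.actWord g w i, ⟨_, tail_mem_chainEnds hL0 hc hL n hg hn⟩), ?_⟩
    funext i
    by_cases hi : i < k
    · simp [f, hi]
    · simp only [f, hi, dif_neg, not_false_eq_true, tail]
      congr 1
      omega
  refine (Set.ncard_le_ncard hsub (Set.toFinite _)).trans ?_
  rw [← Set.image_univ]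
  refine (Set.ncard_image_le (Set.toFinite _)).trans ?_
  rw [Set.ncard_univ, Nat.card_prod, Nat.card_fun]
  simp

theorem HasSubexpGrowth.succ [Finite S] [Finite X] [Nonempty X] (hA : A.IsPolynomial) {H : ℕ}
    (ih : A.HasSubexpGrowth H) : A.HasSubexpGrowth (H + 1) := by
  intro a ha
  -- Blocks grow at rate `b` and chains of them at rate `b ^ 2`; the third factor `b` pays for the
  -- constants `E` of the blocks.
  obtain ⟨b, hb, hba⟩ : ∃ b : ℝ, 1 < b ∧ b ^ 3 = a := by
    refine ⟨a ^ ((3 : ℕ) : ℝ)⁻¹, Real.one_lt_rpow ha (by positivity), ?_⟩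
    exact Real.rpow_inv_natCast_pow (by linarith) (by norm_num)
  have hb0 : 0 < b := by linarith
  obtain ⟨K, hK⟩ := ih b hb
  have hbb : b < b ^ 2 := by nlinarith
  set C : ℝ := |K| + Nat.card S * (Nat.card S * (Nat.card X * |K| + 1)) with hC
  have hC0 : 0 ≤ C := by positivity
  set E : ℝ := max 1 (C * (1 - b / b ^ 2)⁻¹) with hE
  have hE1 : 1 ≤ E := le_max_left _ _
  -- The order of choices matters: `E` does not depend on `k`, so `L` can be fixed first and `k`
  -- taken large in terms of `L`.
  obtain ⟨L, hL0, hLE⟩ : ∃ L, 0 < L ∧ E ^ 2 ≤ b ^ L :=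
    ((Filter.eventually_gt_atTop 0).and
      ((tendsto_pow_atTop_atTop_of_one_lt hb).eventually_ge_atTop _)).exists
  have hlim : ∀ s, ∃ c : ℕ → X, ∀ᶠ k in Filter.atTop, A.height s ≤ H + 1 → ∀ n, k ≤ n → ∀ v,
      H < A.height (A.stateAt s v n) → Set.EqOn v c (Set.Iio n) := by
    intro s
    by_cases hs : A.height s ≤ H + 1
    · obtain ⟨c, hc⟩ := hA.exists_limit_word hs
      exact ⟨c, hc.mono fun k hk _ => hk⟩
    · exact ⟨fun _ => Classical.arbitrary X, Filter.Eventually.of_forall fun _ h => absurd h hs⟩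
  choose c hc using hlim
  obtain ⟨k, hck, hLk⟩ := ((Filter.eventually_all.2 hc).and
    (exists_uniform_depth (A := A) c L)).exists
  refine ⟨Nat.card X ^ k * E ^ 3, fun n w => ?_⟩
  have hblock : ∀ m y, ((A.blockEnds c H k m y).card : ℝ) ≤ C * b ^ m := by
    intro m y
    have hp : 1 ≤ b ^ m := one_le_pow₀ hb.le
    have hKm : ∀ w, ((A.ball H m w).ncard : ℝ) ≤ |K| * b ^ m := fun w =>
      (hK m w).trans (by gcongr; exact le_abs_self K)
    rw [blockEnds, ← Set.ncard_eq_toFinset_card _ ((A.finite_ball H m y).union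
      (finite_runEnds c H k m y))]
    calc ((A.ball H m y ∪ A.runEnds c H k m y).ncard : ℝ)
        ≤ (A.ball H m y).ncard + (A.runEnds c H k m y).ncard := by
          exact_mod_cast Set.ncard_union_le _ _
      _ ≤ |K| * b ^ m + Nat.card S * (Nat.card S * (Nat.card X * (|K| * b ^ m) + 1 * b ^ m)) := by
          refine add_le_add (hKm y) ((ncard_runEnds_le c hKm k y).trans ?_)
          gcongr
          simpa using hp
      _ = C * b ^ m := by rw [hC]; ring
  have hchain := card_chainEnds_le hC0 hb0 hbb hblock (2 * (n / L) + 3) n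
    (one_le_pow₀ hb.le) (tail k w)
  have hpos : 0 ≤ C * (1 - b / b ^ 2)⁻¹ := by
    refine mul_nonneg hC0 (inv_nonneg.2 (sub_nonneg.2 ?_))
    exact (div_le_one (by positivity)).2 hbb.le
  calc ((A.ball (H + 1) n w).ncard : ℝ)
      ≤ Nat.card X ^ k *
          ((chainEnds (A.blockEnds c H k) (2 * (n / L) + 3) n (tail k w)).card : ℝ) := by
        exact_mod_cast ncard_ball_succ_le hL0 hck hLk n w
    _ ≤ Nat.card X ^ k * (E ^ (2 * (n / L) + 3) * (b ^ 2) ^ n) := by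
        gcongr
        exact hchain.trans (by gcongr; exact le_max_right _ _)
    _ = Nat.card X ^ k * ((E ^ 2) ^ (n / L) * E ^ 3 * (b ^ 2) ^ n) := by
        rw [pow_add, pow_mul]
    _ ≤ Nat.card X ^ k * ((b ^ L) ^ (n / L) * E ^ 3 * (b ^ 2) ^ n) := by gcongr
    _ ≤ Nat.card X ^ k * (b ^ n * E ^ 3 * (b ^ 2) ^ n) := by
        rw [← pow_mul]
        gcongr
        · exact hb.le
        · exact Nat.mul_div_le n L
    _ = Nat.card X ^ k * E ^ 3 * a ^ n := by
        rw [← hba, ← pow_mul, ← pow_mul]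
        ring

theorem IsPolynomial.hasSubexpGrowth [Finite S] [Finite X] [Nonempty X] (hA : A.IsPolynomial)
    (H : ℕ) : A.HasSubexpGrowth H := by
  induction H with
  | zero => exact hasSubexpGrowth_zero
  | succ H ih => exact ih.succ hA

end InvAutomaton

/-! ### Almost invariant sets and change of generators. -/

namespace InvAutomaton

variable {S X : Type*} {A : InvAutomaton S X}

theorem actWord_mem_orbit (g : List S) (w : ℕ → X) :
    A.actWord g w ∈ MulAction.orbit A.group w := by
  induction g generalizing w with
  | nil => exact MulAction.mem_orbit_self w
  | cons s g ih =>
    have hs : A.act s w ∈ MulAction.orbit A.group w :=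
      ⟨⟨A.perm s, Subgroup.subset_closure ⟨s, rfl⟩⟩, rfl⟩
    rw [actWord_cons, ← MulAction.orbit_eq_iff.2 hs]
    exact ih _

open Classical in
/-- Every orbit contains finite sets that are almost invariant under all states. -/
theorem IsPolynomial.exists_almost_invariant [Finite S] [Finite X] [Nonempty X]
    (hA : A.IsPolynomial) (w : ℕ → X) {δ : ℝ} (hδ : 0 < δ) :
    ∃ F : Finset (ℕ → X), F.Nonempty ∧ (∀ v ∈ F, v ∈ MulAction.orbit A.group w) ∧
      ∀ s, ((F.image (A.perm s) \ F).card : ℝ) ≤ δ * F.card := by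
  obtain ⟨H, hH⟩ : ∃ H, ∀ s, A.height s ≤ H := by
    obtain ⟨H, hH⟩ := (Set.finite_range A.height).bddAbove
    exact ⟨H, fun s => hH ⟨s, rfl⟩⟩
  let B : ℕ → Finset (ℕ → X) := fun n => (A.finite_ball H n w).toFinset
  have hw : ∀ n, w ∈ B n := fun n => by simp [B, self_mem_ball]
  -- Otherwise the balls would grow at least like `(1 + δ) ^ n`, against subexponential growth at
  -- the smaller rate `1 + δ / 2`.
  obtain ⟨n, hn⟩ : ∃ n, ((B (n + 1)).card : ℝ) ≤ (1 + δ) * (B n).card := by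
    by_contra! hlt
    have hlow : ∀ n, (1 + δ) ^ n ≤ ((B n).card : ℝ) := by
      intro n
      induction n with
      | zero => simpa using Finset.card_pos.2 ⟨w, hw 0⟩
      | succ n ih =>
        rw [pow_succ']
        exact (mul_le_mul_of_nonneg_left ih (by linarith)).trans (hlt n).le
    obtain ⟨K, hK⟩ := hA.hasSubexpGrowth H (1 + δ / 2) (by linarith)
    have hK' : ∀ n, ((1 + δ) / (1 + δ / 2)) ^ n ≤ K := fun n => by
      rw [div_pow, div_le_iff₀ (by positivity)]
      refine (hlow n).trans ?_
      have h := hK n w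
      rwa [Set.ncard_eq_toFinset_card _ (A.finite_ball H n w)] at h
    obtain ⟨n, hn⟩ := pow_unbounded_of_one_lt K
      (show 1 < (1 + δ) / (1 + δ / 2) by rw [lt_div_iff₀ (by positivity)]; linarith)
    exact absurd (hK' n) (not_le.2 hn)
  refine ⟨B n, ⟨w, hw n⟩, fun v hv => ?_, fun s => ?_⟩
  · obtain ⟨g, -, -, rfl⟩ := (A.finite_ball H n w).mem_toFinset.1 hv
    exact actWord_mem_orbit g w
  · have h1 : (B n) ⊆ B (n + 1) := by
      intro v hv
      simp only [B, Set.Finite.mem_toFinset] at hv ⊢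
      obtain ⟨g, hg, h⟩ := hv
      exact ⟨g, hg.trans n.le_succ, h⟩
    have h2 : (B n).image (A.perm s) ⊆ B (n + 1) := by
      intro v hv
      obtain ⟨u, hu, rfl⟩ := Finset.mem_image.1 hv
      simp only [B, Set.Finite.mem_toFinset] at hu ⊢
      obtain ⟨g, hg, -, rfl⟩ := hu
      refine ⟨g ++ [s], by simpa using hg, fun t _ => hH t, ?_⟩
      rw [actWord_append]
      rfl
    have h3 : ((B n).image (A.perm s) \ B n).card + (B n).card ≤ (B (n + 1)).card := by
      rw [Finset.card_sdiff_add_card]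
      exact Finset.card_le_card (Finset.union_subset h2 h1)
    have h4 : (((B n).image (A.perm s) \ B n).card : ℝ) + (B n).card ≤ (B (n + 1)).card := by
      exact_mod_cast h3
    linarith

open Classical in
/-- The displacement of a finite set by an element of the group generated by a set of
permutations is controlled by its displacements by the generators. -/
theorem exists_card_image_sdiff_le {α : Type*} {P : Set (Equiv.Perm α)} {g : Equiv.Perm α}
    (hg : g ∈ Subgroup.closure P) : ∃ C : ℕ, ∀ (F : Finset α) (d : ℕ),
      (∀ p ∈ P, (F.image p \ F).card ≤ d) → (F.image g \ F).card ≤ C * d := by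
  induction hg using Subgroup.closure_induction with
  | mem p hp => exact ⟨1, fun F d h => by simpa using h p hp⟩
  | one => exact ⟨0, fun F d _ => by simp⟩
  | mul g h _ _ hg hh =>
    obtain ⟨C, hC⟩ := hg
    obtain ⟨D, hD⟩ := hh
    refine ⟨C + D, fun F d hd => ?_⟩
    have hsub : F.image (g * h) \ F ⊆ (F.image h \ F).image g ∪ (F.image g \ F) := by
      intro y hy
      simp only [Finset.mem_sdiff, Finset.mem_image, Finset.mem_union, Equiv.Perm.coe_mul,
        Function.comp_apply] at hy ⊢
      obtain ⟨⟨x, hx, rfl⟩, hy⟩ := hy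
      by_cases hhx : h x ∈ F
      · exact Or.inr ⟨⟨_, hhx, rfl⟩, hy⟩
      · exact Or.inl ⟨_, ⟨⟨x, hx, rfl⟩, hhx⟩, rfl⟩
    refine (Finset.card_le_card hsub).trans ((Finset.card_union_le _ _).trans ?_)
    rw [Finset.card_image_of_injective _ g.injective]
    linarith [hC F d hd, hD F d hd]
  | inv g _ hg =>
    obtain ⟨C, hC⟩ := hg
    refine ⟨C, fun F d hd => ?_⟩
    -- Words in the states alone suffice because a permutation and its inverse displace a finite set
    -- equally: `F` and its image have the same size.
    have h1 : (F.image (g⁻¹ : Equiv.Perm α) \ F).image g = F \ F.image g := by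
      rw [Finset.image_sdiff _ _ g.injective, Finset.image_image, ← Equiv.Perm.coe_mul,
        mul_inv_cancel]
      simp
    rw [← Finset.card_image_of_injective _ g.injective, h1]
    have h2 : (F \ F.image g).card = (F.image g \ F).card :=
      Finset.card_sdiff_comm (Finset.card_image_of_injective _ g.injective).symm
    rw [h2]
    exact hC F d hd

end InvAutomaton

theorem corollary2 {X S : Type*} [Finite X] [Nontrivial X] [Finite S]
    (A : InvAutomaton S X) (hmin : A.IsMinimized) (hpoly : A.IsPolynomial)
    (T : Set A.group) (hTfin : T.Finite) (hTgen : Subgroup.closure T = ⊤) (w : ℕ → X) :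
    (orbitalSchreierGraph T w).IsAmenable := by
  classical
  intro ε hε
  -- These constants do not depend on the finite set, so their sum `M` over `T'` is known before the
  -- precision `ε / (M + 1)` is prescribed.
  choose C hC using fun g : A.group => InvAutomaton.exists_card_image_sdiff_le g.2
  set T' : Finset A.group := hTfin.toFinset ∪ hTfin.toFinset.image (·⁻¹) with hT'
  set M : ℕ := ∑ g ∈ T', C g with hM
  obtain ⟨F, hFne, hForb, hF⟩ := hpoly.exists_almost_invariant w
    (show (0 : ℝ) < ε / (M + 1) by positivity)
  obtain ⟨d, hd, hdF⟩ : ∃ d : ℕ, (∀ s, (F.image (A.perm s) \ F).card ≤ d) ∧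
      (d : ℝ) ≤ ε / (M + 1) * F.card := by
    refine ⟨⌊ε / (M + 1) * F.card⌋₊, fun s => Nat.le_floor (hF s), Nat.floor_le (by positivity)⟩
  let F' : Finset (MulAction.orbit A.group w) := F.subtype (· ∈ MulAction.orbit A.group w)
  have hcard : F'.card = F.card := by
    rw [Finset.card_subtype, Finset.filter_true_of_mem hForb]
  have hmem : ∀ v, v ∈ F' ↔ (v : ℕ → X) ∈ F := fun v => Finset.mem_subtype
  let out : A.group → Finset (MulAction.orbit A.group w) := fun g =>
    F'.filter fun v => g • v ∉ F'
  have hsub : (orbitalSchreierGraph T w).outwardBoundary F' ⊆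
      ((T'.biUnion fun g => (out g).image fun v => (v, g • v) :
        Finset (MulAction.orbit A.group w × MulAction.orbit A.group w)) : Set _) := by
    rintro ⟨u, v⟩ ⟨hu, hv, -, g, hg, hgu⟩
    have hguv : g • u = v := Subtype.ext hgu
    simp only [Finset.coe_biUnion, Set.mem_iUnion, Finset.coe_image]
    refine ⟨g, ?_, u, ?_, Prod.ext rfl hguv⟩
    · rw [hT']
      simp only [Finset.coe_union, Finset.coe_image, Set.Finite.coe_toFinset]
      exact hg.imp id fun h => ⟨g⁻¹, h, inv_inv g⟩
    · simpa [out, hguv] using And.intro hu hv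
  have hout : ∀ g : A.group, (out g).card ≤ C g * d := by
    intro g
    refine le_trans ?_ (hC g F d (by rintro _ ⟨s, rfl⟩; exact hd s))
    refine Finset.card_le_card_of_injOn (fun v => (g : Equiv.Perm (ℕ → X)) (v : ℕ → X)) ?_ ?_
    · intro v hv
      have hv' := Finset.mem_filter.1 hv
      rw [hmem, hmem] at hv'
      exact Finset.mem_sdiff.2 ⟨Finset.mem_image_of_mem _ hv'.1, hv'.2⟩
    · intro u _ v _ h
      exact Subtype.ext ((g : Equiv.Perm (ℕ → X)).injective h)
  refine ⟨F', ?_, (Finset.finite_toSet _).subset hsub, ?_⟩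
  · rw [← Finset.card_pos, hcard]
    exact Finset.card_pos.2 hFne
  have hN : ((orbitalSchreierGraph T w).outwardBoundary F').ncard ≤ M * d := by
    refine (Set.ncard_le_ncard hsub (Finset.finite_toSet _)).trans ?_
    rw [Set.ncard_coe_finset, hM, Finset.sum_mul]
    exact Finset.card_biUnion_le.trans (Finset.sum_le_sum fun g _ =>
      Finset.card_image_le.trans (hout g))
  calc (((orbitalSchreierGraph T w).outwardBoundary F').ncard : ℝ)
      ≤ M * d := by exact_mod_cast hN
    _ ≤ (M + 1) * (ε / (M + 1) * F.card) := by gcongr; linarith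
    _ = ε * F'.card := by rw [hcard]; field_simp
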